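/- Let $d\ge 1$ and let $\|\cdot\|$ be a norm on $\mathbb{R}^d$ with dual norm $\|y\|_\star=\sup_{\|x\|\le 1}\langle x,y\rangle$, where $\langle\cdot,\cdot\rangle$ is the standard scalar product. Call a norm $N$ on $\mathbb{R}^d$ orthant-strictly monotonic if $N(x)<N(x')$ whenever $|x_i|\le|x'_i|$ and $x_ix'_i\ge 0$ for all $i$ and $|x_j|<|x'_j|$ for some $j$. For $k\in\{1,\dots,d\}$, let $y\mapsto\sup_{|K|\le k}\|y_K\|_\star$ be the generalized top-$k$ dual norm, where $K$ ranges over the subsets of $\{1,\dots,d\}$ and $y_K$ agrees with $y$ on $K$ and vanishes outside $K$; let the generalized $k$-support dual norm $\|\cdot\|_{(k)}$ be its dual norm, $\|x\|_{(k)}=\sup\{\langle x,y\rangle : \sup_{|K|\le k}\|y_K\|_\star\le 1\}$. Let $\ell_0(x)$ be the number of nonzero components of $x$. Suppose that both $\|\cdot\|$ and $\|\cdot\|_\star$ are orthant-strictly monotonic, let $\varphi:\{0,1,\dots,d\}\to[0,+\infty)$ be nondecreasing with $\varphi(0)=0$, and let $C\subset\mathbb{R}^d$ with $0\notin C$. Then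 $$ \begin{aligned} \min_{x\in C}\varphi(\ell_0(x)) &=\min_{\substack{x\in C,\ x^{(1)},\dots,x^{(d)}\in\mathbb{R}^d\\ \sum_{l=1}^d\|x^{(l)}\|_{(l)}\le 1\\ \sum_{l=1}^d x^{(l)}=x/\|x\|}}\ \sum_{l=1}^d\varphi(l)\,\|x^{(l)}\|_{(l)}\\ &=\min_{\substack{x\in C,\ x^{(1)},\dots,x^{(d)}\in\mathbb{R}^d\\ \sum_{l=1}^d\|x^{(l)}\|_{(l)}\le \|x\|\\ \sum_{l=1}^d x^{(l)}=x}}\ \frac{1}{\|x\|}\sum_{l=1}^d\varphi(l)\,\|x^{(l)}\|_{(l)}\\ &=\min_{x\in C}\ \frac{1}{\|x\|}\ \min_{\substack{x^{(1)},\dots,x^{(d)}\in\mathbb{R}^d\\ \sum_{l=1}^d\|x^{(l)}\|_{(l)}\le \|x\|\\ \sum_{l=1}^d x^{(l)}=x}}\ \sum_{l=1}^d\varphi(l)\,\|x^{(l)}\|_{(l)}, \end{aligned} $$ where all minima are attained (if $C$ is empty, the four minima over $x\in C$ are $+\infty$ by convention), and where, for each $x\in C$, the inner minimization problem in the last line is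 convex: its feasible set is convex and its objective function is convex. -/

import Mathlib

open scoped BigOperators

noncomputable section

namespace SparseReformulation

/-- A norm on `ℝ^d`: a seminorm vanishing only at `0`. It is not tied to any norm that Mathlib
puts on `Fin d → ℝ`. -/
def IsNorm {d : ℕ} (N : Seminorm ℝ (Fin d → ℝ)) : Prop :=
  ∀ x, N x = 0 → x = 0

/-- The number of nonzero components of `x`, as an element of `{0, …, d}`. -/
def l0 {d : ℕ} (x : Fin d → ℝ) : Fin (d + 1) :=
  ⟨(Finset.univ.filter fun i => x i ≠ 0).card,
    Nat.lt_succ_of_le (by simpa using Finset.card_le_univ (Finset.univ.filter fun i => x i ≠ 0))⟩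

/-- The vector `x_K`, which coincides with `x` on `K` and vanishes outside `K`. -/
def coordRestrict {d : ℕ} (K : Finset (Fin d)) (x : Fin d → ℝ) : Fin d → ℝ :=
  fun i => if i ∈ K then x i else 0

/-- The dual norm `y ↦ sup {⟨x, y⟩ : f x ≤ 1}` of `f`, where `f` is (the function of) a norm. -/
def dualNorm {d : ℕ} (f : (Fin d → ℝ) → ℝ) (y : Fin d → ℝ) : ℝ :=
  sSup {r | ∃ x : Fin d → ℝ, f x ≤ 1 ∧ r = x ⬝ᵥ y}

/-- The generalized top-`k` dual norm `y ↦ sup {‖y_K‖_⋆ : #K ≤ k}`. -/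
def topDualNorm {d : ℕ} (f : (Fin d → ℝ) → ℝ) (k : ℕ) (y : Fin d → ℝ) : ℝ :=
  ⨆ K : {K : Finset (Fin d) // K.card ≤ k}, dualNorm f (coordRestrict K.1 y)

/-- The generalized `k`-support dual norm (for `1 ≤ k ≤ d`): the dual norm of the generalized
top-`k` dual norm. -/
def supportDualNorm {d : ℕ} (f : (Fin d → ℝ) → ℝ) (k : ℕ) : (Fin d → ℝ) → ℝ :=
  dualNorm (topDualNorm f k)

/-- `f` is orthant-strictly monotonic: `|x| < |x'|` (componentwise `≤`, with one strict
inequality) and `x ∘ x' ≥ 0` imply `f x < f x'`. -/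
def OrthantStrictlyMonotonic {d : ℕ} (f : (Fin d → ℝ) → ℝ) : Prop :=
  ∀ x x' : Fin d → ℝ, (∀ i, |x i| ≤ |x' i|) → (∃ j, |x j| < |x' j|) →
    (∀ i, 0 ≤ x i * x' i) → f x < f x'

/-- `∑_{l=1}^d ‖z^(l)‖`, with the `l`-support dual norm on the `l`-th vector. The vector `z^(l)`
is `z j` with `l = j + 1`, `j : Fin d`. -/
def totalNorm {d : ℕ} (f : (Fin d → ℝ) → ℝ) (z : Fin d → Fin d → ℝ) : ℝ :=
  ∑ j : Fin d, supportDualNorm f ((j : ℕ) + 1) (z j)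

/-- `∑_{l=1}^d φ(l) ‖z^(l)‖`, with the `l`-support dual norm on the `l`-th vector. -/
def objective {d : ℕ} (f : (Fin d → ℝ) → ℝ) (φ : Fin (d + 1) → ℝ) (z : Fin d → Fin d → ℝ) : ℝ :=
  ∑ j : Fin d, φ j.succ * supportDualNorm f ((j : ℕ) + 1) (z j)

/-- The decompositions `u = ∑_l z^(l)` with `∑_l ‖z^(l)‖ ≤ ρ`. -/
def decompositions {d : ℕ} (f : (Fin d → ℝ) → ℝ) (ρ : ℝ) (u : Fin d → ℝ) :
    Set (Fin d → Fin d → ℝ) :=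
  {z | totalNorm f z ≤ ρ ∧ ∑ j : Fin d, z j = u}

/-- `m` is the minimum of the set `S` of values of a minimization problem: either the problem has
no feasible point and `m = +∞`, or `m` is a real number and is attained. -/
def IsMinValue (S : Set ℝ) (m : EReal) : Prop :=
  (S = ∅ ∧ m = ⊤) ∨ ∃ r : ℝ, IsLeast S r ∧ m = (r : EReal)

end SparseReformulation

end

open scoped BigOperators

namespace SparseReformulation

variable {d : ℕ}

/-! For fixed `x ≠ 0` everything reduces to one claim (`isLeast_objective`): among decompositions of
`x` with budget `N x`, the least objective is `φ (l0 x) * N x`. Normalizing `x` or dividing by `N x`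
then turns each inner minimum into `φ (l0 x)`, which takes finitely many values, so the minimum over
`C` is attained.

The upper bound puts all of `x` at index `l0 x`, where the support dual norm is at most `N x`. For
the lower bound, let `y` be a norming functional of `x`, `s l` the support dual norm of the `l`-th
piece and `τ l ≤ 1` the top-`l` dual norm of `y`. Then `N x = ⟨x, y⟩ ≤ ∑ τ l * s l ≤ ∑ s l ≤ N x`,
so `s l = 0` whenever `τ l < 1`. Strict monotonicity of `N` makes `y` nonzero on the support of `x`;
that of the dual norm then gives `τ l < 1` for `l < l0 x`. Only indices `l ≥ l0 x` carry mass, and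
there `φ l ≥ φ (l0 x)`.

Duality is developed for coercive gauges, so the triangle inequality for top-`k` norms is never
needed. -/

/-- An absolutely homogeneous function that dominates a multiple of every coordinate; unlike a
norm it need not be subadditive. -/
structure IsCoerciveGauge (f : (Fin d → ℝ) → ℝ) : Prop where
  smul : ∀ (t : ℝ) x, f (t • x) = |t| * f x
  coercive : ∃ c > 0, ∀ x i, c * |x i| ≤ f x

/-! ### Duality for coercive gauges -/

namespace IsCoerciveGauge

variable {f : (Fin d → ℝ) → ℝ}

lemma map_zero (hf : IsCoerciveGauge f) : f 0 = 0 := by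
  simpa using hf.smul 0 0

lemma eq_zero (hf : IsCoerciveGauge f) {x : Fin d → ℝ} (hx : f x ≤ 0) : x = 0 := by
  obtain ⟨c, hc, h⟩ := hf.coercive
  funext i
  have h1 := h x i
  have h2 : |x i| ≤ 0 := by
    by_contra hn
    nlinarith [mul_pos hc (not_le.mp hn)]
  simpa using h2

lemma nonneg (hf : IsCoerciveGauge f) (x : Fin d → ℝ) : 0 ≤ f x := by
  by_contra hn
  have hx := hf.eq_zero (not_le.mp hn).le
  rw [hx, hf.map_zero] at hn
  exact hn le_rfl

/-- Coercivity bounds the unit ball, so `dualNorm` is a genuine supremum and not the default value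
of `sSup` on an unbounded set. -/
lemma bddAbove (hf : IsCoerciveGauge f) (y : Fin d → ℝ) :
    BddAbove {r | ∃ x : Fin d → ℝ, f x ≤ 1 ∧ r = x ⬝ᵥ y} := by
  obtain ⟨c, hc, h⟩ := hf.coercive
  refine ⟨∑ i, c⁻¹ * |y i|, ?_⟩
  rintro r ⟨x, hx, rfl⟩
  refine Finset.sum_le_sum fun i _ => ?_
  have h1 : |x i| ≤ c⁻¹ := by
    rw [← one_div, le_div_iff₀ hc]
    linarith [h x i]
  calc x i * y i ≤ |x i * y i| := le_abs_self _
    _ = |x i| * |y i| := abs_mul _ _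
    _ ≤ c⁻¹ * |y i| := mul_le_mul_of_nonneg_right h1 (abs_nonneg _)

lemma dotProduct_le_dualNorm (hf : IsCoerciveGauge f) {x : Fin d → ℝ} (hx : f x ≤ 1)
    (y : Fin d → ℝ) : x ⬝ᵥ y ≤ dualNorm f y :=
  le_csSup (hf.bddAbove y) ⟨x, hx, rfl⟩

lemma dualNorm_le (hf : IsCoerciveGauge f) {y : Fin d → ℝ} {M : ℝ}
    (h : ∀ x, f x ≤ 1 → x ⬝ᵥ y ≤ M) : dualNorm f y ≤ M := by
  refine csSup_le ⟨0, 0, ?_, by simp⟩ ?_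
  · rw [hf.map_zero]
    exact zero_le_one
  · rintro r ⟨x, hx, rfl⟩
    exact h x hx

lemma dualNorm_nonneg (hf : IsCoerciveGauge f) (y : Fin d → ℝ) : 0 ≤ dualNorm f y := by
  have h := hf.dotProduct_le_dualNorm (x := 0) (by rw [hf.map_zero]; exact zero_le_one) y
  simpa using h

lemma dotProduct_le (hf : IsCoerciveGauge f) (x y : Fin d → ℝ) :
    x ⬝ᵥ y ≤ f x * dualNorm f y := by
  rcases (hf.nonneg x).eq_or_lt with h0 | hpos
  · rw [hf.eq_zero h0.ge, hf.map_zero]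
    simp
  · have h := hf.dotProduct_le_dualNorm (x := (f x)⁻¹ • x)
      (by rw [hf.smul, abs_of_pos (inv_pos.mpr hpos), inv_mul_cancel₀ hpos.ne']) y
    rw [smul_dotProduct, smul_eq_mul, inv_mul_le_iff₀ hpos] at h
    exact h

lemma dualNorm_add_le (hf : IsCoerciveGauge f) (y z : Fin d → ℝ) :
    dualNorm f (y + z) ≤ dualNorm f y + dualNorm f z := by
  refine hf.dualNorm_le fun x hx => ?_
  rw [dotProduct_add]
  exact add_le_add (hf.dotProduct_le_dualNorm hx y) (hf.dotProduct_le_dualNorm hx z)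

lemma dualNorm_smul_le (hf : IsCoerciveGauge f) (t : ℝ) (y : Fin d → ℝ) :
    dualNorm f (t • y) ≤ |t| * dualNorm f y := by
  refine hf.dualNorm_le fun x hx => ?_
  have h := hf.dotProduct_le (t • x) y
  rw [hf.smul, smul_dotProduct, ← dotProduct_smul] at h
  refine h.trans (mul_le_mul_of_nonneg_right ?_ (hf.dualNorm_nonneg y))
  exact mul_le_of_le_one_right (abs_nonneg t) hx

lemma dualNorm_smul (hf : IsCoerciveGauge f) (t : ℝ) (y : Fin d → ℝ) :
    dualNorm f (t • y) = |t| * dualNorm f y := by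
  refine le_antisymm (hf.dualNorm_smul_le t y) ?_
  rcases eq_or_ne t 0 with rfl | ht
  · simpa using hf.dualNorm_nonneg 0
  · have h := hf.dualNorm_smul_le t⁻¹ (t • y)
    rw [smul_smul, inv_mul_cancel₀ ht, one_smul, abs_inv] at h
    rwa [le_inv_mul_iff₀ (abs_pos.mpr ht)] at h

lemma exists_pos_mul_abs_le (hf : IsCoerciveGauge f) :
    ∃ c > 0, ∀ y i, c * |y i| ≤ dualNorm f y := by
  -- Pairing `y` with plus and minus the `i`-th basis vector bounds `|y i|`; `S` dominates all the
  -- gauges that occur, and the `1` keeps it positive even for `d = 0`.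
  set S : ℝ := 1 + ∑ i, f (Pi.single i 1) with hS
  have hsum : 0 ≤ ∑ i, f (Pi.single i (1 : ℝ)) := Finset.sum_nonneg fun i _ => hf.nonneg _
  have hSpos : 0 < S := by linarith
  refine ⟨S⁻¹, inv_pos.mpr hSpos, fun y i => ?_⟩
  rw [inv_mul_le_iff₀ hSpos]
  have hle : f (Pi.single i 1) ≤ S := by
    have := Finset.single_le_sum (f := fun i => f (Pi.single i (1 : ℝ)))
      (fun i _ => hf.nonneg _) (Finset.mem_univ i)
    linarith
  have h1 := hf.dotProduct_le (Pi.single i 1) y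
  have h2 := hf.dotProduct_le ((-1 : ℝ) • Pi.single i 1) y
  rw [hf.smul, smul_dotProduct] at h2
  simp only [single_dotProduct, one_mul, abs_neg, abs_one, smul_eq_mul] at h1 h2
  have h3 : f (Pi.single i 1) * dualNorm f y ≤ S * dualNorm f y :=
    mul_le_mul_of_nonneg_right hle (hf.dualNorm_nonneg y)
  exact abs_le.mpr ⟨by linarith, by linarith⟩

/-- The dual of a coercive gauge is a coercive gauge. -/
lemma dual (hf : IsCoerciveGauge f) : IsCoerciveGauge (dualNorm f) :=
  ⟨hf.dualNorm_smul, hf.exists_pos_mul_abs_le⟩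

lemma convexOn_dualNorm (hf : IsCoerciveGauge f) : ConvexOn ℝ Set.univ (dualNorm f) := by
  refine ⟨convex_univ, fun x _ y _ a b ha hb _ => ?_⟩
  refine (hf.dualNorm_add_le _ _).trans_eq ?_
  rw [hf.dualNorm_smul, hf.dualNorm_smul, abs_of_nonneg ha, abs_of_nonneg hb, smul_eq_mul,
    smul_eq_mul]

end IsCoerciveGauge

/-! ### Top-`k` dual norms -/

lemma coordRestrict_smul (K : Finset (Fin d)) (t : ℝ) (y : Fin d → ℝ) :
    coordRestrict K (t • y) = t • coordRestrict K y := by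
  funext i
  simp [coordRestrict]

lemma dualNorm_coordRestrict_le_topDualNorm (f : (Fin d → ℝ) → ℝ) {k : ℕ}
    {K : Finset (Fin d)} (hK : K.card ≤ k) (y : Fin d → ℝ) :
    dualNorm f (coordRestrict K y) ≤ topDualNorm f k y :=
  le_ciSup (f := fun K : {K : Finset (Fin d) // K.card ≤ k} =>
    dualNorm f (coordRestrict K.1 y)) (Set.finite_range _).bddAbove ⟨K, hK⟩

lemma exists_topDualNorm_eq (f : (Fin d → ℝ) → ℝ) (k : ℕ) (y : Fin d → ℝ) :
    ∃ K : Finset (Fin d), K.card ≤ k ∧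
      topDualNorm f k y = dualNorm f (coordRestrict K y) := by
  have : Nonempty {K : Finset (Fin d) // K.card ≤ k} := ⟨⟨∅, by simp⟩⟩
  obtain ⟨K, hK⟩ := exists_eq_ciSup_of_finite
    (f := fun K : {K : Finset (Fin d) // K.card ≤ k} => dualNorm f (coordRestrict K.1 y))
  exact ⟨K.1, K.2, hK.symm⟩

/-- The top-`k` dual norm of a coercive gauge is a coercive gauge, if `1 ≤ k`. -/
lemma IsCoerciveGauge.topDualNorm {f : (Fin d → ℝ) → ℝ} (hf : IsCoerciveGauge f) {k : ℕ}
    (hk : 1 ≤ k) : IsCoerciveGauge (topDualNorm f k) := by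
  refine ⟨fun t y => ?_, ?_⟩
  · simp only [SparseReformulation.topDualNorm, coordRestrict_smul, hf.dualNorm_smul]
    exact (Real.mul_iSup_of_nonneg (abs_nonneg t) _).symm
  · obtain ⟨c, hc, h⟩ := hf.exists_pos_mul_abs_le
    refine ⟨c, hc, fun y i => ?_⟩
    -- As `1 ≤ k`, the singleton `{i}` is an admissible set `K`.
    have h1 := h (coordRestrict {i} y) i
    have h2 : coordRestrict {i} y i = y i := by simp [coordRestrict]
    rw [h2] at h1
    exact h1.trans (dualNorm_coordRestrict_le_topDualNorm f (by simpa using hk) y)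

/-! ### Convexity of the inner problem -/

lemma convexOn_objective {f : (Fin d → ℝ) → ℝ} (hf : IsCoerciveGauge f)
    {φ : Fin (d + 1) → ℝ} (hφ : ∀ k, 0 ≤ φ k) : ConvexOn ℝ Set.univ (objective f φ) := by
  refine ⟨convex_univ, fun x _ y _ a b ha hb hab => ?_⟩
  simp only [objective, smul_eq_mul, Finset.mul_sum, ← Finset.sum_add_distrib]
  refine Finset.sum_le_sum fun j _ => ?_
  have h := (hf.topDualNorm (Nat.le_add_left 1 (j : ℕ))).convexOn_dualNorm.2
    (Set.mem_univ (x j)) (Set.mem_univ (y j)) ha hb hab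
  have h' := mul_le_mul_of_nonneg_left h (hφ j.succ)
  simp only [smul_eq_mul] at h'
  refine h'.trans_eq ?_
  simp only [supportDualNorm]
  ring

/-- With constant weight `1`, facts about the objective also apply to the constraint. -/
lemma totalNorm_eq_objective (f : (Fin d → ℝ) → ℝ) : totalNorm f = objective f 1 := by
  funext z
  simp [totalNorm, objective]

lemma convex_decompositions {f : (Fin d → ℝ) → ℝ} (hf : IsCoerciveGauge f) (ρ : ℝ)
    (u : Fin d → ℝ) : Convex ℝ (decompositions f ρ u) := by
  have h1 := (convexOn_objective hf (φ := 1) fun _ => zero_le_one).convex_le ρ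
  intro x hx y hy a b ha hb hab
  refine ⟨?_, ?_⟩
  · have h := h1 ⟨Set.mem_univ x, by rw [← totalNorm_eq_objective]; exact hx.1⟩
      ⟨Set.mem_univ y, by rw [← totalNorm_eq_objective]; exact hy.1⟩ ha hb hab
    rw [totalNorm_eq_objective]
    exact h.2
  · simp only [Pi.add_apply, Pi.smul_apply, Finset.sum_add_distrib, ← Finset.smul_sum, hx.2, hy.2]
    rw [← add_smul, hab, one_smul]

/-! ### Norms as gauges, norming functionals -/

lemma IsNorm.pos {N : Seminorm ℝ (Fin d → ℝ)} (hN : IsNorm N) {x : Fin d → ℝ} (hx : x ≠ 0) :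
    0 < N x :=
  (apply_nonneg N x).lt_of_ne fun h => hx (hN x h.symm)

/-- The coercivity constant is the minimum of `N` on the compact sup-norm unit sphere, which is
empty only for `d = 0`. -/
lemma IsNorm.isCoerciveGauge {N : Seminorm ℝ (Fin d → ℝ)} (hN : IsNorm N) :
    IsCoerciveGauge N := by
  refine ⟨fun t x => by rw [map_smul_eq_mul, Real.norm_eq_abs], ?_⟩
  have hcont : Continuous N :=
    continuousOn_univ.mp (N.convexOn.continuousOn isOpen_univ)
  rcases (Metric.sphere (0 : Fin d → ℝ) 1).eq_empty_or_nonempty with he | hne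
  · refine ⟨1, one_pos, fun x i => ?_⟩
    exfalso
    have : (fun _ => 1 : Fin d → ℝ) ∈ Metric.sphere (0 : Fin d → ℝ) 1 := by
      have : Nonempty (Fin d) := ⟨i⟩
      rw [mem_sphere_zero_iff_norm, pi_norm_const, norm_one]
    rw [he] at this
    exact this
  · obtain ⟨x₀, hx₀, hmin⟩ := (isCompact_sphere (0 : Fin d → ℝ) 1).exists_isMinOn hne
      hcont.continuousOn
    have hx₀0 : x₀ ≠ 0 := by
      rintro rfl
      simp at hx₀
    refine ⟨N x₀, hN.pos hx₀0, fun x i => ?_⟩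
    rcases eq_or_ne x 0 with rfl | hx
    · simp
    · have hxpos := norm_pos_iff.mpr hx
      have h : N x₀ ≤ N (‖x‖⁻¹ • x) := hmin (by
        rw [mem_sphere_zero_iff_norm, norm_smul, norm_inv, norm_norm,
          inv_mul_cancel₀ hxpos.ne'])
      rw [map_smul_eq_mul, norm_inv, norm_norm, le_inv_mul_iff₀ hxpos] at h
      have h2 : |x i| ≤ ‖x‖ := norm_le_pi_norm x i
      calc N x₀ * |x i| ≤ N x₀ * ‖x‖ := mul_le_mul_of_nonneg_left h2 (apply_nonneg _ _)
        _ ≤ N x := by linarith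

/-- A norming functional for `x`: a vector `y` of dual norm at most `1` with `⟨x, y⟩ = N x`. -/
lemma IsNorm.exists_dual_vector {N : Seminorm ℝ (Fin d → ℝ)} (hN : IsNorm N) {x : Fin d → ℝ}
    (hx : x ≠ 0) : ∃ y : Fin d → ℝ, dualNorm N y ≤ 1 ∧ x ⬝ᵥ y = N x := by
  -- Hahn–Banach: the functional `t • x ↦ t * N x` on the line through `x` is dominated by `N` and
  -- extends with the same domination.
  let p : (Fin d → ℝ) →ₗ.[ℝ] ℝ := LinearPMap.mkSpanSingleton x (N x) hx
  obtain ⟨g, hg, hle⟩ := exists_extension_of_le_sublinear p N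
    (fun c hc v => by rw [map_smul_eq_mul, Real.norm_of_nonneg hc.le])
    (fun v w => map_add_le_add N v w) (by
      rintro ⟨v, hv⟩
      obtain ⟨t, rfl⟩ := Submodule.mem_span_singleton.mp hv
      have h1 : p ⟨t • x, hv⟩ = t • N x := LinearPMap.mkSpanSingleton'_apply _ _ _ _ _
      rw [h1, map_smul_eq_mul, smul_eq_mul]
      exact mul_le_mul_of_nonneg_right (le_abs_self t) (apply_nonneg N x))
  have hdot : ∀ v : Fin d → ℝ, v ⬝ᵥ (fun i => g (Pi.single i 1)) = g v := by
    intro v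
    rw [LinearMap.pi_apply_eq_sum_univ g v]
    simp only [dotProduct, smul_eq_mul]
    refine Finset.sum_congr rfl fun i _ => ?_
    congr 2
    funext j
    simp [Pi.single_apply, eq_comm]
  refine ⟨fun i => g (Pi.single i 1), hN.isCoerciveGauge.dualNorm_le fun v hv => ?_, ?_⟩
  · rw [hdot]
    exact (hle v).trans hv
  · rw [hdot]
    have h2 := hg ⟨x, Submodule.mem_span_singleton_self x⟩
    rw [h2]
    exact LinearPMap.mkSpanSingleton_apply ℝ ℝ hx (N x)

/-! ### Consequences of orthant-strict monotonicity -/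

lemma dotProduct_coordRestrict (K : Finset (Fin d)) (x y : Fin d → ℝ) :
    x ⬝ᵥ coordRestrict K y = coordRestrict K x ⬝ᵥ y := by
  simp [dotProduct, coordRestrict]

lemma coordRestrict_eq_self {K : Finset (Fin d)} {x : Fin d → ℝ} (h : ∀ i ∉ K, x i = 0) :
    coordRestrict K x = x := by
  funext i
  by_cases hi : i ∈ K <;> simp [coordRestrict, hi, h i]

lemma OrthantStrictlyMonotonic.coordRestrict_lt {f : (Fin d → ℝ) → ℝ}
    (hf : OrthantStrictlyMonotonic f) {K : Finset (Fin d)} {x : Fin d → ℝ} {j : Fin d}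
    (hj : j ∉ K) (hxj : x j ≠ 0) : f (coordRestrict K x) < f x := by
  refine hf _ _ (fun i => ?_) ⟨j, ?_⟩ fun i => ?_
  · by_cases hi : i ∈ K <;> simp [coordRestrict, hi]
  · simp [coordRestrict, hj, hxj]
  · by_cases hi : i ∈ K <;> simp [coordRestrict, hi, mul_self_nonneg]

lemma OrthantStrictlyMonotonic.coordRestrict_le {f : (Fin d → ℝ) → ℝ}
    (hf : OrthantStrictlyMonotonic f) (K : Finset (Fin d)) (x : Fin d → ℝ) :
    f (coordRestrict K x) ≤ f x := by
  by_cases h : ∃ j ∉ K, x j ≠ 0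
  · obtain ⟨j, hj, hxj⟩ := h
    exact (hf.coordRestrict_lt hj hxj).le
  · push Not at h
    rw [coordRestrict_eq_self h]

lemma OrthantStrictlyMonotonic.topDualNorm_le {f : (Fin d → ℝ) → ℝ}
    (hf : OrthantStrictlyMonotonic (dualNorm f)) (k : ℕ) (y : Fin d → ℝ) :
    topDualNorm f k y ≤ dualNorm f y := by
  obtain ⟨K, _, h⟩ := exists_topDualNorm_eq f k y
  rw [h]
  exact hf.coordRestrict_le K y

lemma OrthantStrictlyMonotonic.topDualNorm_lt {f : (Fin d → ℝ) → ℝ}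
    (hf : OrthantStrictlyMonotonic (dualNorm f)) {k : ℕ} {y : Fin d → ℝ}
    (hk : k < (Finset.univ.filter fun i => y i ≠ 0).card) :
    topDualNorm f k y < dualNorm f y := by
  obtain ⟨K, hK, h⟩ := exists_topDualNorm_eq f k y
  obtain ⟨j, hj, hjK⟩ := Finset.exists_mem_notMem_of_card_lt_card (hK.trans_lt hk)
  rw [h]
  exact hf.coordRestrict_lt hjK (Finset.mem_filter.mp hj).2

/-- For an orthant-strictly monotonic norm, every dual vector of `x` is nonzero on the support
of `x`. -/
lemma ne_zero_of_dual_vector {N : Seminorm ℝ (Fin d → ℝ)} (hN : IsNorm N)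
    (hmono : OrthantStrictlyMonotonic N) {x y : Fin d → ℝ} (hy : dualNorm N y ≤ 1)
    (hxy : x ⬝ᵥ y = N x) {i : Fin d} (hi : x i ≠ 0) : y i ≠ 0 := by
  intro hyi
  -- If `y i = 0`, deleting coordinate `i` keeps the pairing with `y` equal to `N x` but strictly
  -- lowers the norm.
  have h1 : N (coordRestrict (Finset.univ.erase i) x) < N x :=
    hmono.coordRestrict_lt (by simp) hi
  have h2 := hN.isCoerciveGauge.dotProduct_le (coordRestrict (Finset.univ.erase i) x) y
  rw [← dotProduct_coordRestrict, coordRestrict_eq_self (x := y), hxy] at h2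
  · exact absurd (h2.trans (mul_le_of_le_one_right (apply_nonneg N _) hy)) (not_le.mpr h1)
  · intro j hj
    obtain rfl : j = i := by simpa using hj
    exact hyi

/-- Pairing with `x` only sees `y` on the support of `x`, a set admissible in the top-`k` dual norm.
-/
lemma supportDualNorm_le {f : (Fin d → ℝ) → ℝ} (hf : IsCoerciveGauge f) {k : ℕ} (hk : 1 ≤ k)
    {x : Fin d → ℝ} (hx : (l0 x : ℕ) ≤ k) : supportDualNorm f k x ≤ f x := by
  refine (hf.topDualNorm hk).dualNorm_le fun y hy => ?_
  set K := Finset.univ.filter fun i => x i ≠ 0 with hKdef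
  have hxK : coordRestrict K x = x := coordRestrict_eq_self fun i hi => by
    simpa [hKdef] using hi
  have hyK : dualNorm f (coordRestrict K y) ≤ 1 :=
    (dualNorm_coordRestrict_le_topDualNorm f hx y).trans hy
  rw [dotProduct_comm, ← hxK, ← dotProduct_coordRestrict, hxK]
  exact (hf.dotProduct_le _ _).trans (mul_le_of_le_one_right (hf.nonneg x) hyK)

lemma l0_ne_zero {x : Fin d → ℝ} (hx : x ≠ 0) : l0 x ≠ 0 := by
  intro h
  apply hx
  funext i
  by_contra hi
  have h1 : (Finset.univ.filter fun i => x i ≠ 0).card = 0 := congrArg Fin.val h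
  rw [Finset.card_eq_zero] at h1
  have h2 : i ∈ Finset.univ.filter fun i => x i ≠ 0 := by simpa using hi
  rw [h1] at h2
  simp at h2

lemma l0_smul {t : ℝ} (ht : t ≠ 0) (x : Fin d → ℝ) : l0 (t • x) = l0 x := by
  simp [l0, ht]

/-! ### The inner minimum -/

/-- The decomposition of `x` with the single term `x`, at the index `l0 x`, is feasible, and its
value is at most `φ (l0 x) * N x`. -/
lemma exists_decomposition {N : Seminorm ℝ (Fin d → ℝ)} (hN : IsNorm N)
    {φ : Fin (d + 1) → ℝ} (hφ : ∀ k, 0 ≤ φ k) {x : Fin d → ℝ} (hx : x ≠ 0) :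
    ∃ z ∈ decompositions N (N x) x, objective N φ z ≤ φ (l0 x) * N x := by
  have hf := hN.isCoerciveGauge
  obtain ⟨j, hj⟩ := Fin.exists_succ_eq.mpr (l0_ne_zero hx)
  -- The weight is arbitrary so that `ψ = 1` gives feasibility and `ψ = φ` the value.
  have hobj : ∀ ψ : Fin (d + 1) → ℝ,
      objective N ψ (Pi.single j x) = ψ (l0 x) * supportDualNorm N ((j : ℕ) + 1) x := by
    intro ψ
    rw [objective, Finset.sum_eq_single j]
    · rw [Pi.single_eq_same, hj]
    · intro i _ hi
      rw [Pi.single_eq_of_ne hi, supportDualNorm,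
        (hf.topDualNorm (Nat.le_add_left 1 (i : ℕ))).dual.map_zero, mul_zero]
    · simp
  have hle : supportDualNorm N ((j : ℕ) + 1) x ≤ N x :=
    supportDualNorm_le hf (Nat.le_add_left 1 _) (by rw [← hj, Fin.val_succ])
  refine ⟨Pi.single j x, ⟨?_, ?_⟩, ?_⟩
  · rw [totalNorm_eq_objective, hobj]
    simpa using hle
  · simp
  · rw [hobj]
    exact mul_le_mul_of_nonneg_left hle (hφ _)

/-- Every decomposition of `x` has value at least `φ (l0 x) * N x`. -/
lemma mul_le_objective {N : Seminorm ℝ (Fin d → ℝ)} (hN : IsNorm N)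
    (hmono : OrthantStrictlyMonotonic N) (hmonoDual : OrthantStrictlyMonotonic (dualNorm N))
    {φ : Fin (d + 1) → ℝ} (hφ : ∀ k, 0 ≤ φ k) (hφ_mono : Monotone φ) {x : Fin d → ℝ}
    (hx : x ≠ 0) {z : Fin d → Fin d → ℝ} (hz : z ∈ decompositions N (N x) x) :
    φ (l0 x) * N x ≤ objective N φ z := by
  have hf := hN.isCoerciveGauge
  obtain ⟨y, hy, hxy⟩ := hN.exists_dual_vector hx
  set s : Fin d → ℝ := fun j => supportDualNorm N ((j : ℕ) + 1) (z j) with hs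
  set τ : Fin d → ℝ := fun j => topDualNorm N ((j : ℕ) + 1) y with hτ
  have hgauge : ∀ j : Fin d, IsCoerciveGauge (topDualNorm N ((j : ℕ) + 1)) := fun j =>
    hf.topDualNorm (Nat.le_add_left 1 _)
  have hs0 : ∀ j, 0 ≤ s j := fun j => (hgauge j).dualNorm_nonneg _
  have hτ1 : ∀ j, τ j ≤ 1 := fun j => (hmonoDual.topDualNorm_le _ y).trans hy
  have hτlt : ∀ j : Fin d, j.succ < l0 x → τ j < 1 := by
    intro j hj
    refine (hmonoDual.topDualNorm_lt ?_).trans_le hy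
    refine lt_of_lt_of_le (b := (Finset.univ.filter fun i => x i ≠ 0).card) hj
      (Finset.card_le_card fun i hi => ?_)
    simp only [Finset.mem_filter, Finset.mem_univ, true_and] at hi ⊢
    exact ne_zero_of_dual_vector hN hmono hy hxy hi
  have hsum : ∑ j, s j ≤ N x := hz.1
  have hpair : N x ≤ ∑ j, τ j * s j := by
    rw [← hxy, ← hz.2, dotProduct_comm, dotProduct_sum]
    exact Finset.sum_le_sum fun j _ => (hgauge j).dotProduct_le y (z j)
  have hle : ∀ j ∈ Finset.univ, τ j * s j ≤ s j := fun j _ =>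
    mul_le_of_le_one_left (hs0 j) (hτ1 j)
  -- The chain `N x ≤ ∑ τ j * s j ≤ ∑ s j ≤ N x` collapses, forcing equality term by term.
  have heq : ∀ j, τ j * s j = s j := fun j =>
    (Finset.sum_eq_sum_iff_of_le hle).mp
      (le_antisymm (Finset.sum_le_sum hle) (hsum.trans hpair)) j (Finset.mem_univ j)
  have hterm : ∀ j, φ (l0 x) * s j ≤ φ j.succ * s j := by
    intro j
    rcases lt_or_ge j.succ (l0 x) with hj | hj
    · have h0 : s j = 0 := by
        by_contra hne
        exact (hτlt j hj).ne (mul_right_cancel₀ hne (by rw [heq j, one_mul]))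
      rw [h0, mul_zero, mul_zero]
    · exact mul_le_mul_of_nonneg_right (hφ_mono hj) (hs0 j)
  calc φ (l0 x) * N x ≤ φ (l0 x) * ∑ j, s j :=
        mul_le_mul_of_nonneg_left (hpair.trans (Finset.sum_le_sum hle)) (hφ _)
    _ = ∑ j, φ (l0 x) * s j := Finset.mul_sum _ _ _
    _ ≤ objective N φ z := Finset.sum_le_sum fun j _ => hterm j

lemma isLeast_objective {N : Seminorm ℝ (Fin d → ℝ)} (hN : IsNorm N)
    (hmono : OrthantStrictlyMonotonic N) (hmonoDual : OrthantStrictlyMonotonic (dualNorm N))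
    {φ : Fin (d + 1) → ℝ} (hφ : ∀ k, 0 ≤ φ k) (hφ_mono : Monotone φ) {x : Fin d → ℝ}
    (hx : x ≠ 0) :
    IsLeast (objective N φ '' decompositions N (N x) x) (φ (l0 x) * N x) := by
  obtain ⟨z, hz, hle⟩ := exists_decomposition hN hφ hx
  refine ⟨⟨z, hz, le_antisymm hle (mul_le_objective hN hmono hmonoDual hφ hφ_mono hx hz)⟩, ?_⟩
  rintro _ ⟨w, hw, rfl⟩
  exact mul_le_objective hN hmono hmonoDual hφ hφ_mono hx hw

/-! ### Minimizing over `C` -/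

/-- If every fibre `S x`, `x ∈ C`, has the least element `a x`, and `a` takes finitely many
values, then the union of the fibres has the same minimum value as `a` on `C`. -/
lemma exists_isMinValue {α : Type*} (C : Set α) (a : α → ℝ) (ha : (Set.range a).Finite) :
    ∃ m : EReal, ∀ S : α → Set ℝ, (∀ x ∈ C, IsLeast (S x) (a x)) →
      IsMinValue {t | ∃ x ∈ C, t ∈ S x} m := by
  rcases C.eq_empty_or_nonempty with rfl | hne
  · exact ⟨⊤, fun S _ => Or.inl ⟨by simp, rfl⟩⟩
  · obtain ⟨r, ⟨x₀, hx₀, rfl⟩, hr⟩ :=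
      (ha.subset (Set.image_subset_range a C)).exists_minimal (hne.image a)
    refine ⟨(a x₀ : EReal), fun S hS => Or.inr ⟨a x₀, ⟨⟨x₀, hx₀, (hS x₀ hx₀).1⟩, ?_⟩, rfl⟩⟩
    rintro t ⟨x, hx, ht⟩
    refine le_trans ?_ ((hS x hx).2 ht)
    rcases le_total (a x₀) (a x) with h | h
    · exact h
    · exact hr ⟨x, hx, rfl⟩ h

end SparseReformulation

theorem mainTheorem5 {d : ℕ} (C : Set (Fin d → ℝ)) (hC : (0 : Fin d → ℝ) ∉ C)
    (N : Seminorm ℝ (Fin d → ℝ)) (hN : SparseReformulation.IsNorm N)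
    (hmono : SparseReformulation.OrthantStrictlyMonotonic N)
    (hmonoDual : SparseReformulation.OrthantStrictlyMonotonic (SparseReformulation.dualNorm N))
    (φ : Fin (d + 1) → ℝ) (hφ_nonneg : ∀ k, 0 ≤ φ k) (hφ_mono : Monotone φ) (hφ_zero : φ 0 = 0) :
    -- the four minima exist (`+∞` if `C` is empty) and are equal
    (∃ m : EReal,
      SparseReformulation.IsMinValue {t | ∃ x ∈ C, t = φ (SparseReformulation.l0 x)} m ∧
      SparseReformulation.IsMinValue
        {t | ∃ x ∈ C, ∃ z ∈ SparseReformulation.decompositions N 1 ((N x)⁻¹ • x),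
          t = SparseReformulation.objective N φ z} m ∧
      SparseReformulation.IsMinValue
        {t | ∃ x ∈ C, ∃ z ∈ SparseReformulation.decompositions N (N x) x,
          t = 1 / N x * SparseReformulation.objective N φ z} m ∧
      SparseReformulation.IsMinValue
        {t | ∃ x ∈ C, ∃ v : ℝ,
          IsLeast (SparseReformulation.objective N φ ''
            SparseReformulation.decompositions N (N x) x) v ∧ t = 1 / N x * v} m) ∧
    -- for every `x ∈ C` the inner problem attains its minimum and is a convex problem
    ∀ x ∈ C,
      (∃ v : ℝ, IsLeast (SparseReformulation.objective N φ ''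
        SparseReformulation.decompositions N (N x) x) v) ∧
      Convex ℝ (SparseReformulation.decompositions N (N x) x) ∧
      ConvexOn ℝ Set.univ (SparseReformulation.objective N φ) := by
  have hpos : ∀ x ∈ C, x ≠ 0 := fun x hx h => hC (h ▸ hx)
  have hleast := fun x (hx : x ∈ C) =>
    SparseReformulation.isLeast_objective hN hmono hmonoDual hφ_nonneg hφ_mono (hpos x hx)
  refine ⟨?_, fun x hx => ⟨⟨_, hleast x hx⟩,
    SparseReformulation.convex_decompositions hN.isCoerciveGauge _ _,
    SparseReformulation.convexOn_objective hN.isCoerciveGauge hφ_nonneg⟩⟩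
  obtain ⟨m, hm⟩ := SparseReformulation.exists_isMinValue C
    (fun x => φ (SparseReformulation.l0 x))
    ((Set.finite_range φ).subset (Set.range_comp_subset_range _ φ))
  have hdiv : ∀ x ∈ C,
      1 / N x * (φ (SparseReformulation.l0 x) * N x) = φ (SparseReformulation.l0 x) := by
    intro x hx
    have := (hN.pos (hpos x hx)).ne'
    field_simp
  refine ⟨m, hm (fun x => {φ (SparseReformulation.l0 x)}) fun x _ => isLeast_singleton,
    hm (fun x => {t | ∃ z ∈ SparseReformulation.decompositions N 1 ((N x)⁻¹ • x),
      t = SparseReformulation.objective N φ z}) fun x hx => ?_,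
    hm (fun x => {t | ∃ z ∈ SparseReformulation.decompositions N (N x) x,
      t = 1 / N x * SparseReformulation.objective N φ z}) fun x hx => ?_,
    hm (fun x => {t | ∃ v : ℝ, IsLeast (SparseReformulation.objective N φ ''
      SparseReformulation.decompositions N (N x) x) v ∧ t = 1 / N x * v}) fun x hx => ?_⟩
  · have hNx := hN.pos (hpos x hx)
    have hunit : N ((N x)⁻¹ • x) = 1 := by
      rw [map_smul_eq_mul, Real.norm_of_nonneg (inv_nonneg.mpr hNx.le), inv_mul_cancel₀ hNx.ne']
    -- The inner claim at the normalized vector, which has norm `1` and the same `l0` as `x`.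
    have h := SparseReformulation.isLeast_objective hN hmono hmonoDual hφ_nonneg hφ_mono
      (smul_ne_zero (inv_ne_zero hNx.ne') (hpos x hx))
    rw [hunit, mul_one, SparseReformulation.l0_smul (inv_ne_zero hNx.ne')] at h
    obtain ⟨⟨z, hz, hzv⟩, hmin⟩ := h
    refine ⟨⟨z, hz, hzv.symm⟩, ?_⟩
    rintro t ⟨w, hw, rfl⟩
    exact hmin ⟨w, hw, rfl⟩
  · obtain ⟨⟨z, hz, hzv⟩, hmin⟩ := hleast x hx
    refine ⟨⟨z, hz, by rw [hzv, hdiv x hx]⟩, ?_⟩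
    rintro t ⟨w, hw, rfl⟩
    rw [← hdiv x hx]
    exact mul_le_mul_of_nonneg_left (hmin ⟨w, hw, rfl⟩) (one_div_nonneg.mpr (apply_nonneg N x))
  · refine ⟨⟨_, hleast x hx, (hdiv x hx).symm⟩, ?_⟩
    rintro t ⟨v, hv, rfl⟩
    rw [hv.unique (hleast x hx), hdiv x hx]
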